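/- Let $F$ be an Archimedean (real) vector lattice, i.e. $\bigwedge_{n\ge 1}\frac1n f=0$ for every $f\in F_+$. An ideal of $F$ is a solid linear subspace; a band is an ideal that contains the supremum of each of its subsets that has a supremum in $F$. An ideal $H$ is a projection band if $F=H+H^{d}$, where $H^{d}=\{f\in F:\ |f|\wedge|h|=0\text{ for all }h\in H\}$. $F$ has the projection property (PP) if every band of $F$ is a projection band, and $\sigma$-PP if every countably generated band (i.e. every smallest band containing some countable set) is a projection band. For $e\in F$ let $I_e=\{f\in F:\ |f|\le\alpha|e|\text{ for some real }\alpha\ge 0\}$. A Krein–Kakutani spectrum of $e$ is a compact Hausdorff space $K$ such that $I_e$ is isomorphic, as a vector lattice, to a dense sublattice of $\mathcal C(K)$ with the supremum norm. A compact Hausdorff space is extremally (resp. basically) disconnected if the closure of each open set (resp. of each cozero set $\{x: f(x)\neq 0\}$, $f\in\mathcal C(K)$) is open. Then: 1. $F$ has PP if and only if for every $e\in F$ the Krein–Kakutani spectrum of $e$ is extremally disconnected. 2. $F$ has $\sigma$-PP if and only if for every $e\in F$ the Krein–Kakutani spectrum of $e$ is basically disconnected. In both parts it makes no difference whether the condition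 on $e$ is required of every Krein–Kakutani spectrum of $e$, or whether it is only required that $e$ has some Krein–Kakutani spectrum with the property: for each part, the two versions of the condition and the property of $F$ are all equivalent. -/

import Mathlib

universe u

namespace VectorLattice

section VL

variable {F : Type*} [AddCommGroup F] [Lattice F] [IsOrderedAddMonoid F] [Module ℝ F]
  [IsOrderedModule ℝ F]

variable (F) in
/-- A vector lattice is Archimedean if the infimum of `(1/n) f`, `n = 1, 2, …`, exists and is `0`,
for every `f ≥ 0`. -/
def IsArchimedean : Prop :=
  ∀ f : F, 0 ≤ f → IsGLB (Set.range fun n : ℕ => (1 / ((n : ℝ) + 1)) • f) 0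

/-- An ideal of a vector lattice: a solid linear subspace. -/
def IsIdeal (H : Submodule ℝ F) : Prop :=
  LatticeOrderedAddCommGroup.IsSolid (H : Set F)

/-- A band: an ideal containing the supremum of each of its subsets that has a supremum. -/
def IsBand (H : Submodule ℝ F) : Prop :=
  IsIdeal H ∧ ∀ S : Set F, S ⊆ H → ∀ f : F, IsLUB S f → f ∈ H

/-- The disjoint complement of a set `G`: all `f` with `|f| ⊓ |g| = 0` for every `g ∈ G`. -/
def disjointComplement (G : Set F) : Set F :=
  {f | ∀ g ∈ G, |f| ⊓ |g| = 0}

/-- A projection band: an ideal `H` such that `F = H + Hᵈ`. -/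
def IsProjectionBand (H : Submodule ℝ F) : Prop :=
  IsIdeal H ∧ ∀ f : F, ∃ g ∈ H, ∃ h ∈ disjointComplement (H : Set F), f = g + h

/-- `H` is the band generated by `G`: the smallest band containing `G`. -/
def IsBandGeneratedBy (H : Submodule ℝ F) (G : Set F) : Prop :=
  IsBand H ∧ G ⊆ H ∧ ∀ H' : Submodule ℝ F, IsBand H' → G ⊆ H' → H ≤ H'

variable (F) in
/-- The projection property (PP). -/
def HasPP : Prop :=
  ∀ H : Submodule ℝ F, IsBand H → IsProjectionBand H

variable (F) in
/-- The property `σ`-PP: every countably generated band is a projection band. -/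
def HasSigmaPP : Prop :=
  ∀ H : Submodule ℝ F, (∃ G : Set F, G.Countable ∧ IsBandGeneratedBy H G) → IsProjectionBand H

/-- The principal ideal `I_e` generated by `e`: all `f` with `|f| ≤ α |e|` for some `α ≥ 0`. -/
def principalIdeal (e : F) : Submodule ℝ F where
  carrier := {f | ∃ α : ℝ, 0 ≤ α ∧ |f| ≤ α • |e|}
  zero_mem' := ⟨0, le_rfl, by simp⟩
  add_mem' := by
    rintro a b ⟨α, hα, ha⟩ ⟨β, hβ, hb⟩
    refine ⟨α + β, add_nonneg hα hβ, ?_⟩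
    rw [add_smul]
    exact (abs_add_le a b).trans (add_le_add ha hb)
  smul_mem' := by
    rintro c a ⟨α, hα, ha⟩
    refine ⟨|c| * α, mul_nonneg (abs_nonneg c) hα, ?_⟩
    have h1 : |c • a| ≤ |c| • |a| := by
      refine abs_le'.2 ⟨?_, ?_⟩
      · rcases le_total 0 c with hc | hc
        · rw [abs_of_nonneg hc]
          exact smul_le_smul_of_nonneg_left (le_abs_self a) hc
        · have h := smul_le_smul_of_nonneg_left (neg_le_abs a) (neg_nonneg.2 hc)
          rw [abs_of_nonpos hc]
          simpa using h
      · rcases le_total 0 c with hc | hc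
        · have h := smul_le_smul_of_nonneg_left (neg_le_abs a) hc
          rw [abs_of_nonneg hc]
          simpa using h
        · have h := smul_le_smul_of_nonneg_left (le_abs_self a) (neg_nonneg.2 hc)
          rw [abs_of_nonpos hc]
          simpa using h
    rw [mul_smul]
    exact h1.trans (smul_le_smul_of_nonneg_left ha (abs_nonneg c))

theorem isIdeal_principalIdeal (e : F) : IsIdeal (principalIdeal e) := by
  rintro x ⟨α, hα, hx⟩ y hy
  exact ⟨α, hα, hy.trans hx⟩

theorem sup_mem_principalIdeal {e f g : F} (hf : f ∈ principalIdeal e)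
    (hg : g ∈ principalIdeal e) : f ⊔ g ∈ principalIdeal e := by
  obtain ⟨α, hα, hf⟩ := hf
  obtain ⟨β, hβ, hg⟩ := hg
  refine ⟨α + β, add_nonneg hα hβ, ?_⟩
  have h1 : |f| ≤ (α + β) • |e| := by
    rw [add_smul]
    exact hf.trans (le_add_of_nonneg_right (smul_nonneg hβ (abs_nonneg e)))
  have h2 : |g| ≤ (α + β) • |e| := by
    rw [add_smul]
    exact hg.trans (le_add_of_nonneg_left (smul_nonneg hα (abs_nonneg e)))
  refine abs_le'.2 ⟨sup_le (abs_le'.1 h1).1 (abs_le'.1 h2).1, ?_⟩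
  exact (neg_le_neg le_sup_left).trans (abs_le'.1 h1).2

theorem inf_mem_principalIdeal {e f g : F} (hf : f ∈ principalIdeal e)
    (hg : g ∈ principalIdeal e) : f ⊓ g ∈ principalIdeal e := by
  have h := neg_mem (sup_mem_principalIdeal (neg_mem hf) (neg_mem hg))
  rwa [neg_sup, neg_neg, neg_neg] at h

/-- The vector sublattice `I_e` is a lattice with the operations of `F`. -/
instance instLatticePrincipalIdeal (e : F) : Lattice (principalIdeal e) :=
  Subtype.lattice (fun _ _ => sup_mem_principalIdeal) (fun _ _ => inf_mem_principalIdeal)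

/-- `K` is a Krein–Kakutani spectrum of `e`: a compact Hausdorff space such that `I_e` is
isomorphic, as a vector lattice, to a dense sublattice of `C(K, ℝ)`, that is, there is an injective
linear lattice homomorphism `I_e → C(K, ℝ)` whose range is dense (in the compact-open
topology, which is the topology of the supremum norm as `K` is compact). -/
def IsKreinKakutaniSpectrum (e : F) (K : Type*) [TopologicalSpace K] : Prop :=
  CompactSpace K ∧ T2Space K ∧
    ∃ T : principalIdeal e →ₗ[ℝ] C(K, ℝ),
      (∀ f g, T (f ⊔ g) = T f ⊔ T g) ∧ (∀ f g, T (f ⊓ g) = T f ⊓ T g) ∧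
        Function.Injective T ∧ DenseRange T

end VL

/-- A space is basically disconnected if the closure of each cozero set is open. -/
def BasicallyDisconnected (X : Type*) [TopologicalSpace X] : Prop :=
  ∀ f : C(X, ℝ), IsOpen (closure {x | f x ≠ 0})

end VectorLattice

/-!
Fix `e` in an Archimedean vector lattice `F` and a dense representation `T : I_e → C(K)` of the
principal ideal `I_e`. The image of the order unit `|e|` is positive everywhere, so a function
`φ ∈ C(K)` can be approximated up to a small multiple of `T |e|`, and truncating the approximation
gives elements of `I_e` supported in `{φ ≠ 0}` (`IsDenseRepresentation.exists_truncation`). Three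
consequences carry the argument: every open set is a union of supports of elements of `I_e`
(`exists_bump`), every cozero set is a countable such union (`exists_iUnion_eq_cozero`), and
for every clopen `V ⊆ K` the function `1_V • T |e|` is exactly in the range of `T`
(`exists_component`).

*Projections give open closures.* Let `U` be the union of the supports of a set `B ⊆ I_e`. If the
band generated by `B` is a projection band, then `|e| = g + h` with `g` in the band and `h` disjoint
from it, and `closure U = {T g ≠ 0} = {T h = 0}` is clopen
(`isOpen_closure_of_isProjectionBand`). Arbitrary `B` yields all open sets, countable `B` all
cozero sets.

*Open closures give projections.* Let `H` be the band generated by `G`, let `f ≥ 0`, and represent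
`I_f`. If the union of the supports of the `|g| ⊓ f`, `g ∈ G`, has open closure `V`, then the
component `p` of `f` carried by `V` is the projection of `f` to `H`: clearly `f - p` is
disjoint from `G`, and `p` is the supremum of the elements of `H` in `[0, p]` because `F` is
Archimedean (`exists_decomposition_of_isOpen_closure`). For countable `G` the union in question is a
cozero set (`exists_cozero_eq_biUnion`).

These two implications show that the property of `F` gives the condition on all spectra and follows
from the condition on some spectrum of each `e`. That a spectrum exists
(`exists_isDenseRepresentation`) is the Krein–Kakutani theorem: the points of `K` are the
real lattice homomorphisms on `I_e` with value `1` at `|e|`. A maximal proper ideal is the kernel of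
such a homomorphism, which gives enough of them to separate the elements of `I_e`, and density is
the lattice form of the Stone–Weierstrass theorem.
-/

namespace VectorLattice

/-! ### Disjointness and bands -/

section Bands

variable {F : Type*} [AddCommGroup F] [Lattice F] [IsOrderedAddMonoid F]

theorem add_inf_le_inf_add_inf {a b c : F} (ha : 0 ≤ a) (hb : 0 ≤ b) (hc : 0 ≤ c) :
    (a + b) ⊓ c ≤ a ⊓ c + b ⊓ c := by
  rw [add_inf, inf_add, inf_add]
  refine le_inf (le_inf inf_le_left ?_) (le_inf ?_ ?_)
  · exact inf_le_right.trans (le_add_of_nonneg_right hb)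
  · exact inf_le_right.trans (le_add_of_nonneg_left ha)
  · exact inf_le_right.trans (le_add_of_nonneg_left hc)

theorem abs_inf_abs_eq_zero_of_le {x y z : F} (h : |x| ⊓ |z| = 0) (hyx : |y| ≤ |x|) :
    |y| ⊓ |z| = 0 :=
  le_antisymm ((inf_le_inf_right _ hyx).trans h.le) (le_inf (abs_nonneg _) (abs_nonneg _))

theorem abs_le_of_disjoint_add {g h f : F} (hgh : |g| ⊓ |h| = 0) (hf : f = g + h) :
    |g| ≤ |f| := by
  have h1 : |g| ≤ |f| + |h| := by
    have : g = f + -h := by rw [hf]; abel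
    calc |g| = |f + -h| := by rw [← this]
      _ ≤ |f| + |-h| := abs_add_le _ _
      _ = |f| + |h| := by rw [abs_neg]
  calc |g| = (|f| + |h|) ⊓ |g| := (inf_eq_right.2 h1).symm
    _ ≤ |f| ⊓ |g| + |h| ⊓ |g| :=
      add_inf_le_inf_add_inf (abs_nonneg _) (abs_nonneg _) (abs_nonneg _)
    _ = |f| ⊓ |g| := by rw [inf_comm |h|, hgh, add_zero]
    _ ≤ |f| := inf_le_left

variable [Module ℝ F] [IsOrderedModule ℝ F]

theorem inf_smul_le {x y : F} (hx : 0 ≤ x) (hy : 0 ≤ y) {c : ℝ} (hc : 0 ≤ c) :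
    x ⊓ c • y ≤ (1 + c) • (x ⊓ y) := by
  have hc' : 0 < 1 + c := by positivity
  have hz : 0 ≤ x ⊓ c • y := le_inf hx (smul_nonneg hc hy)
  have key : (1 + c)⁻¹ • (x ⊓ c • y) ≤ x ⊓ y := by
    refine le_inf ?_ ?_
    · calc (1 + c)⁻¹ • (x ⊓ c • y) ≤ (1 : ℝ) • (x ⊓ c • y) :=
            smul_le_smul_of_nonneg_right (inv_le_one_of_one_le₀ (by linarith)) hz
        _ = x ⊓ c • y := one_smul _ _
        _ ≤ x := inf_le_left
    · calc (1 + c)⁻¹ • (x ⊓ c • y) ≤ (1 + c)⁻¹ • (c • y) :=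
            smul_le_smul_of_nonneg_left inf_le_right (inv_nonneg.2 hc'.le)
        _ = ((1 + c)⁻¹ * c) • y := smul_smul _ _ _
        _ ≤ (1 : ℝ) • y := by
            refine smul_le_smul_of_nonneg_right ?_ hy
            rw [inv_mul_le_iff₀ hc']; linarith
        _ = y := one_smul _ _
  have := smul_le_smul_of_nonneg_left key hc'.le
  rwa [smul_smul, mul_inv_cancel₀ hc'.ne', one_smul] at this

omit [IsOrderedAddMonoid F] in
theorem abs_smul_le (c : ℝ) (a : F) : |c • a| ≤ |c| • |a| := by
  rcases le_total 0 c with hc | hc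
  · rw [abs_of_nonneg hc]
    refine abs_le'.2 ⟨smul_le_smul_of_nonneg_left (le_abs_self a) hc, ?_⟩
    rw [← smul_neg]
    exact smul_le_smul_of_nonneg_left (neg_le_abs a) hc
  · rw [abs_of_nonpos hc]
    refine abs_le'.2 ⟨?_, ?_⟩
    · rw [← neg_smul_neg]
      exact smul_le_smul_of_nonneg_left (neg_le_abs a) (neg_nonneg.2 hc)
    · rw [← neg_smul]
      exact smul_le_smul_of_nonneg_left (le_abs_self a) (neg_nonneg.2 hc)

/-- The disjoint complement of a set as a linear subspace. -/
def disjointSubmodule (G : Set F) : Submodule ℝ F where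
  carrier := disjointComplement G
  zero_mem' := fun g _ => by simp
  add_mem' := by
    intro a b ha hb g hg
    refine le_antisymm ?_ (le_inf (abs_nonneg _) (abs_nonneg _))
    calc |a + b| ⊓ |g| ≤ (|a| + |b|) ⊓ |g| := inf_le_inf_right _ (abs_add_le _ _)
      _ ≤ |a| ⊓ |g| + |b| ⊓ |g| :=
        add_inf_le_inf_add_inf (abs_nonneg _) (abs_nonneg _) (abs_nonneg _)
      _ = 0 := by rw [ha g hg, hb g hg, add_zero]
  smul_mem' := by
    intro c a ha g hg
    refine le_antisymm ?_ (le_inf (abs_nonneg _) (abs_nonneg _))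
    calc |c • a| ⊓ |g| ≤ |g| ⊓ |c| • |a| := by
          rw [inf_comm]; exact inf_le_inf_left _ (abs_smul_le c a)
      _ ≤ (1 + |c|) • (|g| ⊓ |a|) := inf_smul_le (abs_nonneg _) (abs_nonneg _) (abs_nonneg _)
      _ = 0 := by rw [inf_comm, ha g hg, smul_zero]

theorem isIdeal_disjointSubmodule (G : Set F) : IsIdeal (disjointSubmodule G) :=
  fun _ hx _ hy g hg => abs_inf_abs_eq_zero_of_le (hx g hg) hy

/-- Disjoint complements are bands. If `f = sup S` with `S` disjoint from `g` and
`k = f⁺ ⊓ |g|`, then `f - k` is still an upper bound of `S`, whence `k = 0`. -/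
theorem isBand_disjointSubmodule (G : Set F) : IsBand (disjointSubmodule G) := by
  refine ⟨isIdeal_disjointSubmodule G, fun S hS f hf g hg => ?_⟩
  have hneg : f⁻ ⊓ |g| = 0 := by
    refine le_antisymm ?_ (le_inf (negPart_nonneg f) (abs_nonneg g))
    rcases S.eq_empty_or_nonempty with rfl | ⟨s, hs⟩
    · -- a supremum of the empty set is a least element
      have := hf.2 (by simp [upperBounds] : f - f⁻ ⊓ |g| ∈ upperBounds (∅ : Set F))
      simpa using this
    · have h1 : f⁻ ≤ |s| := by
        refine (negPart_anti (hf.1 hs)).trans ?_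
        rw [← posPart_add_negPart s]
        exact le_add_of_nonneg_left (posPart_nonneg s)
      exact (inf_le_inf_right _ h1).trans (hS hs g hg).le
  have hpos : f⁺ ⊓ |g| = 0 := by
    have hk0 : 0 ≤ f⁺ ⊓ |g| := le_inf (posPart_nonneg f) (abs_nonneg g)
    refine le_antisymm ?_ hk0
    have hub : f - f⁺ ⊓ |g| ∈ upperBounds S := by
      intro s hs
      have h1 : s⁺ ⊓ (f⁺ ⊓ |g|) = 0 := by
        refine le_antisymm ?_ (le_inf (posPart_nonneg s) hk0)
        refine (inf_le_inf ?_ inf_le_right).trans (hS hs g hg).le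
        rw [← posPart_add_negPart s]
        exact le_add_of_nonneg_right (negPart_nonneg s)
      have h2 : s⁺ + f⁺ ⊓ |g| ≤ f⁺ := by
        rw [← inf_add_sup, h1, zero_add]
        exact sup_le (posPart_mono (hf.1 hs)) inf_le_left
      have h3 : f⁻ ≤ s⁻ := negPart_anti (hf.1 hs)
      rw [le_sub_iff_add_le]
      calc s + f⁺ ⊓ |g| = (s⁺ + f⁺ ⊓ |g|) - s⁻ := by
            conv_lhs => rw [← posPart_sub_negPart s]
            abel
        _ ≤ f⁺ - f⁻ := sub_le_sub h2 h3
        _ = f := posPart_sub_negPart f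
    have := hf.2 hub
    rwa [le_sub_self_iff] at this
  refine le_antisymm ?_ (le_inf (abs_nonneg _) (abs_nonneg _))
  calc |f| ⊓ |g| = (f⁺ + f⁻) ⊓ |g| := by rw [posPart_add_negPart]
    _ ≤ f⁺ ⊓ |g| + f⁻ ⊓ |g| :=
      add_inf_le_inf_add_inf (posPart_nonneg f) (negPart_nonneg f) (abs_nonneg g)
    _ = 0 := by rw [hpos, hneg, add_zero]

omit [IsOrderedAddMonoid F] [IsOrderedModule ℝ F] in
theorem exists_isBandGeneratedBy (G : Set F) :
    ∃ H : Submodule ℝ F, IsBandGeneratedBy H G := by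
  refine ⟨sInf {H | IsBand H ∧ G ⊆ H}, ⟨?_, ?_⟩, ?_, fun H' h1 h2 => sInf_le ⟨h1, h2⟩⟩
  · intro x hx y hy
    simp only [SetLike.mem_coe, Submodule.mem_sInf] at hx ⊢
    exact fun H hH => hH.1.1 (hx H hH) hy
  · intro S hS f hf
    rw [Submodule.mem_sInf]
    exact fun H hH => hH.1.2 S (fun s hs => Submodule.mem_sInf.1 (hS hs) H hH) f hf
  · intro g hg
    simp only [SetLike.mem_coe, Submodule.mem_sInf]
    exact fun H hH => hH.2 hg

/-- An element disjoint from `G` is disjoint from the band generated by `G`. -/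
theorem IsBandGeneratedBy.disjoint {H : Submodule ℝ F} {G : Set F} (hH : IsBandGeneratedBy H G)
    {f g : F} (hf : ∀ g ∈ G, |f| ⊓ |g| = 0) (hg : g ∈ H) : |f| ⊓ |g| = 0 := by
  have h := hH.2.2 (disjointSubmodule {f}) (isBand_disjointSubmodule _) (fun x hx y hy => by
    rw [Set.mem_singleton_iff.1 hy, inf_comm]; exact hf x hx)
  rw [inf_comm]
  exact h hg f rfl

omit [IsOrderedModule ℝ F] in
theorem abs_mem_of_isIdeal {H : Submodule ℝ F} (hH : IsIdeal H) {f : F} (hf : f ∈ H) :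
    |f| ∈ H :=
  hH hf (abs_abs f).le

omit [IsOrderedModule ℝ F] in
theorem mem_of_isIdeal_of_le {H : Submodule ℝ F} (hH : IsIdeal H) {f g : F} (hg : g ∈ H)
    (h0 : 0 ≤ f) (hfg : f ≤ g) : f ∈ H :=
  hH hg (by rwa [abs_of_nonneg h0, abs_of_nonneg (h0.trans hfg)])

omit [IsOrderedAddMonoid F] in
theorem IsArchimedean.nonpos_of_nsmul_le (hF : IsArchimedean F) {x y : F} (hy : 0 ≤ y)
    (h : ∀ n : ℕ, ((n : ℝ) + 1) • x ≤ y) : x ≤ 0 := by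
  refine (hF y hy).2 ?_
  rintro _ ⟨n, rfl⟩
  have hn : (0 : ℝ) < n + 1 := by positivity
  have := smul_le_smul_of_nonneg_left (h n) (one_div_pos.2 hn).le
  rwa [smul_smul, one_div_mul_cancel hn.ne', one_smul] at this

end Bands

/-! ### Order units and dense representations -/

section Representation

variable {E : Type*} [AddCommGroup E] [Lattice E] [Module ℝ E]

/-- `u` is a strong order unit: `u ≥ 0`, and every element is dominated by a multiple of `u`. -/
def IsStrongUnit (u : E) : Prop :=
  0 ≤ u ∧ ∀ f : E, ∃ α : ℝ, 0 ≤ α ∧ |f| ≤ α • u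

variable {K : Type*} [TopologicalSpace K]

/-- `T` is an isomorphism of the vector lattice `E` onto a dense sublattice of `C(K, ℝ)`. -/
structure IsDenseRepresentation (T : E →ₗ[ℝ] C(K, ℝ)) : Prop where
  map_sup : ∀ f g, T (f ⊔ g) = T f ⊔ T g
  map_inf : ∀ f g, T (f ⊓ g) = T f ⊓ T g
  injective : Function.Injective T
  dense : DenseRange T

namespace IsDenseRepresentation

variable {T : E →ₗ[ℝ] C(K, ℝ)} (hT : IsDenseRepresentation T)
include hT

theorem sup_apply (f g : E) (x : K) : T (f ⊔ g) x = T f x ⊔ T g x := by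
  rw [hT.map_sup]; rfl

theorem inf_apply (f g : E) (x : K) : T (f ⊓ g) x = T f x ⊓ T g x := by
  rw [hT.map_inf]; rfl

theorem abs_apply (f : E) (x : K) : T |f| x = |T f x| := by
  change T (f ⊔ -f) x = T f x ⊔ -T f x
  rw [hT.sup_apply, map_neg]; rfl

theorem eq_of_apply {f g : E} (h : ∀ x, T f x = T g x) : f = g :=
  hT.injective (ContinuousMap.ext h)

theorem mono {f g : E} (h : f ≤ g) (x : K) : T f x ≤ T g x := by
  have := hT.sup_apply f g x
  rw [sup_eq_right.2 h] at this
  exact this ▸ le_sup_left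

theorem nonneg {f : E} (h : 0 ≤ f) (x : K) : 0 ≤ T f x := by
  simpa using hT.mono h x

theorem disjoint_iff {f g : E} : |f| ⊓ |g| = 0 ↔ ∀ x, T f x = 0 ∨ T g x = 0 := by
  have key : ∀ x, T (|f| ⊓ |g|) x = |T f x| ⊓ |T g x| := fun x => by
    rw [hT.inf_apply, hT.abs_apply, hT.abs_apply]
  constructor
  · intro h x
    have h1 := key x
    rw [h, map_zero, ContinuousMap.zero_apply] at h1
    rcases min_choice |T f x| |T g x| with h2 | h2 <;> rw [h2] at h1
    · exact Or.inl (abs_eq_zero.1 h1.symm)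
    · exact Or.inr (abs_eq_zero.1 h1.symm)
  · intro h
    refine hT.eq_of_apply fun x => ?_
    rw [key, map_zero, ContinuousMap.zero_apply]
    rcases h x with h | h <;> simp [h]

variable [CompactSpace K] {u : E} (hu : IsStrongUnit u)
include hu

/-- The image of a strong unit vanishes nowhere: otherwise every `T f` would vanish at the same
point, and the range of `T` would not be dense. -/
theorem unit_pos (x : K) : 0 < T u x := by
  refine (hT.nonneg hu.1 x).lt_of_ne' fun h0 => ?_
  obtain ⟨p, hp⟩ := Metric.denseRange_iff.1 hT.dense (1 : C(K, ℝ)) 1 one_pos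
  have h1 : T p x = 0 := by
    obtain ⟨α, hα, h⟩ := hu.2 p
    have := hT.mono h x
    rw [hT.abs_apply, map_smul, ContinuousMap.smul_apply, h0, smul_zero] at this
    exact abs_nonpos_iff.1 this
  have h2 := (ContinuousMap.dist_apply_le_dist x).trans_lt hp
  simp [h1] at h2

theorem exists_approx (c : C(K, ℝ)) {ε : ℝ} (hε : 0 < ε) :
    ∃ p : E, ∀ x, |T p x - c x| < ε * T u x := by
  rcases isEmpty_or_nonempty K with hK | hK
  · exact ⟨0, fun x => (hK.false x).elim⟩
  obtain ⟨x₀, -, hx₀⟩ := isCompact_univ.exists_isMinOn Set.univ_nonempty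
    (T u).continuous.continuousOn
  obtain ⟨p, hp⟩ := Metric.denseRange_iff.1 hT.dense c (ε * T u x₀)
    (mul_pos hε (hT.unit_pos hu x₀))
  refine ⟨p, fun x => ?_⟩
  rw [← Real.dist_eq, dist_comm]
  exact ((ContinuousMap.dist_apply_le_dist x).trans_lt hp).trans_le
    (mul_le_mul_of_nonneg_left (hx₀ (Set.mem_univ x)) hε.le)

/-- Subtracting a small multiple of the unit from an approximation of `φ` and taking the positive
part gives an element of `E` whose support lies in that of `φ` and which is positive where `φ` is
not too small. -/
theorem exists_truncation (φ : C(K, ℝ)) {ε : ℝ} (hε : 0 < ε) :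
    ∃ b : E, 0 ≤ b ∧ (∀ x, φ x = 0 → T b x = 0) ∧
      ∀ x, 2 * ε * T u x ≤ φ x → φ x - 2 * ε * T u x < T b x := by
  obtain ⟨p, hp⟩ := hT.exists_approx hu φ hε
  have key : ∀ x, T ((p - ε • u) ⊔ 0) x = (T p x - ε * T u x) ⊔ 0 := fun x => by
    rw [hT.sup_apply]; simp
  refine ⟨(p - ε • u) ⊔ 0, le_sup_right, fun x hx => ?_, fun x hx => ?_⟩
  · have := hp x
    rw [hx, sub_zero] at this
    rw [key, sup_eq_right]
    linarith [(abs_lt.1 this).2]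
  · have := (abs_lt.1 (hp x)).1
    rw [key]
    exact lt_sup_of_lt_left (by linarith)

theorem exists_bump [T2Space K] {U : Set K} (hU : IsOpen U) {x : K} (hx : x ∈ U) :
    ∃ f : E, 0 ≤ f ∧ (∀ y ∉ U, T f y = 0) ∧ 0 < T f x := by
  obtain ⟨c, hc0, hc1, -⟩ := exists_continuous_zero_one_of_isClosed hU.isClosed_compl
    isClosed_singleton (Set.disjoint_singleton_right.2 (by simpa using hx))
  obtain ⟨b, hb, h0, h1⟩ := hT.exists_truncation hu ((3 : ℝ) • (c * T u)) one_pos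
  have hcx : c x = 1 := hc1 rfl
  have hpos := hT.unit_pos hu x
  refine ⟨b, hb, fun y hy => h0 y ?_, ?_⟩
  · have : c y = 0 := hc0 hy
    simp [this]
  · have := h1 x (by simp [hcx]; linarith)
    simp [hcx] at this
    linarith

/-- The range of `T`, although merely dense, contains the component of the unit carried by each
clopen set. -/
theorem exists_component {V : Set K} (hV : IsClopen V) :
    ∃ p : E, 0 ≤ p ∧ p ≤ u ∧ (∀ x ∈ V, T p x = T u x) ∧ ∀ x ∉ V, T p x = 0 := by
  classical
  let c : C(K, ℝ) := ⟨V.indicator 1, (IsClopen.continuous_indicator hV) continuous_one⟩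
  obtain ⟨b, hb, h0, h1⟩ := hT.exists_truncation hu ((3 : ℝ) • (c * T u)) one_pos
  refine ⟨b ⊓ u, le_inf hb hu.1, inf_le_right, fun x hx => ?_, fun x hx => ?_⟩
  · have hcx : c x = 1 := Set.indicator_of_mem hx _
    have hpos := hT.unit_pos hu x
    have := h1 x (by simp [hcx]; linarith)
    simp [hcx] at this
    rw [hT.inf_apply, inf_eq_right]
    linarith
  · have hcx : c x = 0 := Set.indicator_of_notMem hx _
    rw [hT.inf_apply, h0 x (by simp [hcx])]
    exact inf_eq_left.2 (hT.nonneg hu.1 x)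

theorem exists_iUnion_eq_cozero (φ : C(K, ℝ)) :
    ∃ b : ℕ → E, {x | φ x ≠ 0} = ⋃ n, {x | T (b n) x ≠ 0} := by
  choose b _ h0 h1 using fun n : ℕ => hT.exists_truncation hu |φ|
    (Nat.one_div_pos_of_nat (α := ℝ) (n := n))
  refine ⟨b, Set.ext fun x => ?_⟩
  simp only [Set.mem_iUnion, Set.mem_ofPred_eq]
  constructor
  · intro hx
    have hpos := hT.unit_pos hu x
    have hφ : 0 < |φ x| / (2 * T u x) := div_pos (abs_pos.2 hx) (by positivity)
    obtain ⟨n, hn⟩ := exists_nat_one_div_lt hφ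
    have h2 : 2 * (1 / ((n : ℝ) + 1)) * T u x ≤ |φ| x := by
      rw [lt_div_iff₀ (by positivity)] at hn
      rw [ContinuousMap.abs_apply]
      linarith
    exact ⟨n, ((sub_nonneg.2 h2).trans_lt (h1 n x h2)).ne'⟩
  · rintro ⟨n, hn⟩ hx
    exact hn (h0 n x (by rw [ContinuousMap.abs_apply, hx, abs_zero]))

/-- If the unit splits as `u = g + h` with `h` disjoint from `B` and `g` disjoint from everything
disjoint from `B`, then the closure of the union of the supports of `B` is the clopen set
`{T g ≠ 0} = {T h = 0}`. -/
theorem isOpen_closure_of_decomposition [T2Space K] {B : Set E} {g h : E} (hgh : u = g + h)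
    (hd : |g| ⊓ |h| = 0) (hh : ∀ b ∈ B, |h| ⊓ |b| = 0)
    (hg : ∀ f : E, (∀ b ∈ B, |f| ⊓ |b| = 0) → |f| ⊓ |g| = 0) :
    IsOpen (closure (⋃ b ∈ B, {x | T b x ≠ 0})) := by
  have hV : {x | T g x ≠ 0} = {x | T h x = 0} := by
    ext x
    have hpos := hT.unit_pos hu x
    rw [hgh, map_add, ContinuousMap.add_apply] at hpos
    rcases hT.disjoint_iff.1 hd x with h | h
    · rw [h, zero_add] at hpos; simp [h, hpos.ne']
    · rw [h, add_zero] at hpos; simp [h, hpos.ne']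
  have hopen : IsOpen {x | T g x ≠ 0} := isOpen_ne_fun (T g).continuous continuous_const
  suffices closure (⋃ b ∈ B, {x | T b x ≠ 0}) = {x | T g x ≠ 0} by rwa [this]
  refine subset_antisymm (closure_minimal ?_ ?_) fun x hx => ?_
  · rw [hV]
    refine Set.iUnion₂_subset fun b hb x hx => ?_
    exact (hT.disjoint_iff.1 (hh b hb) x).resolve_right hx
  · rw [hV]
    exact isClosed_eq (T h).continuous continuous_const
  · by_contra hxc
    obtain ⟨f, -, hf0, hfx⟩ := hT.exists_bump hu isClosed_closure.isOpen_compl hxc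
    have hfg : |f| ⊓ |g| = 0 := hg f fun b hb => hT.disjoint_iff.2 fun y => by
      by_cases hy : T b y = 0
      · exact Or.inr hy
      · exact Or.inl (hf0 y (not_not.2 (subset_closure (Set.mem_biUnion hb hy))))
    exact (hT.disjoint_iff.1 hfg x).elim hfx.ne' hx

end IsDenseRepresentation
end Representation
/-! ### Existence of a dense representation -/

section Existence

variable {E : Type*} [AddCommGroup E] [Lattice E] [IsOrderedAddMonoid E] [Module ℝ E]
  [IsOrderedModule ℝ E]

/-- The ideal generated by an ideal `M` and an element `a ≥ 0`. -/
def idealSup (M : Submodule ℝ E) (a : E) : Submodule ℝ E where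
  carrier := {f | ∃ m ∈ M, 0 ≤ m ∧ ∃ α : ℝ, 0 ≤ α ∧ |f| ≤ m + α • a}
  zero_mem' := ⟨0, zero_mem _, le_rfl, 0, le_rfl, by simp⟩
  add_mem' := by
    rintro f g ⟨m, hm, hm0, α, hα, hf⟩ ⟨n, hn, hn0, β, hβ, hg⟩
    refine ⟨m + n, add_mem hm hn, add_nonneg hm0 hn0, α + β, add_nonneg hα hβ, ?_⟩
    calc |f + g| ≤ |f| + |g| := abs_add_le _ _
      _ ≤ (m + α • a) + (n + β • a) := add_le_add hf hg
      _ = m + n + (α + β) • a := by rw [add_smul]; abel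
  smul_mem' := by
    rintro c f ⟨m, hm, hm0, α, hα, hf⟩
    refine ⟨|c| • m, M.smul_mem _ hm, smul_nonneg (abs_nonneg _) hm0, |c| * α,
      mul_nonneg (abs_nonneg _) hα, ?_⟩
    rw [mul_smul, ← smul_add]
    exact (abs_smul_le c f).trans (smul_le_smul_of_nonneg_left hf (abs_nonneg c))

omit [IsOrderedAddMonoid E] [IsOrderedModule ℝ E] in
theorem exists_maximal_ideal {u : E} {M₀ : Submodule ℝ E} (h₀ : IsIdeal M₀) (hu : u ∉ M₀) :
    ∃ M, M₀ ≤ M ∧ Maximal (fun M : Submodule ℝ E => IsIdeal M ∧ u ∉ M) M := by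
  refine zorn_le_nonempty₀ {M : Submodule ℝ E | IsIdeal M ∧ u ∉ M} ?_ M₀ ⟨h₀, hu⟩
  intro c hc hchain y hy
  have hmem : ∀ z, z ∈ sSup c ↔ ∃ N ∈ c, z ∈ N := fun z =>
    Submodule.mem_sSup_of_directed ⟨y, hy⟩ hchain.directedOn
  refine ⟨sSup c, ⟨fun f hf g hg => ?_, fun hu' => ?_⟩, fun N hN => le_sSup hN⟩
  · obtain ⟨N, hN, hfN⟩ := (hmem f).1 hf
    exact (hmem g).2 ⟨N, hN, (hc hN).1 hfN hg⟩
  · obtain ⟨N, hN, huN⟩ := (hmem u).1 hu'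
    exact (hc hN).2 huN

theorem exists_le_add_smul_of_maximal {u : E} {M : Submodule ℝ E}
    (hM : Maximal (fun M : Submodule ℝ E => IsIdeal M ∧ u ∉ M) M) {a : E} (ha : 0 ≤ a)
    (haM : a ∉ M) : ∃ m ∈ M, 0 ≤ m ∧ ∃ α : ℝ, 0 ≤ α ∧ u ≤ m + α • a := by
  have hideal : IsIdeal (idealSup M a) := by
    rintro f ⟨m, hm, hm0, α, hα, hf⟩ g hg
    exact ⟨m, hm, hm0, α, hα, hg.trans hf⟩
  have hle : M ≤ idealSup M a := fun f hf =>
    ⟨|f|, abs_mem_of_isIdeal hM.prop.1 hf, abs_nonneg f, 0, le_rfl, by simp⟩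
  have ha' : a ∈ idealSup M a :=
    ⟨0, zero_mem _, le_rfl, 1, zero_le_one, by simp [abs_of_nonneg ha]⟩
  by_contra hne
  refine haM (hM.le_of_ge ⟨hideal, ?_⟩ hle ha')
  rintro ⟨m, hm, hm0, α, hα, h⟩
  exact hne ⟨m, hm, hm0, α, hα, (le_abs_self u).trans h⟩

/-- Maximal proper ideals are prime. -/
theorem negPart_mem_of_maximal {u : E} (hu : IsStrongUnit u) {M : Submodule ℝ E}
    (hM : Maximal (fun M : Submodule ℝ E => IsIdeal M ∧ u ∉ M) M) {g : E} (hg : g⁺ ∉ M) :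
    g⁻ ∈ M := by
  obtain ⟨m, hm, hm0, α, hα, h⟩ :=
    exists_le_add_smul_of_maximal hM (posPart_nonneg g) hg
  obtain ⟨β, hβ, hβg⟩ := hu.2 g⁻
  rw [abs_of_nonneg (negPart_nonneg g)] at hβg
  refine mem_of_isIdeal_of_le hM.prop.1 (M.smul_mem β hm) (negPart_nonneg g) ?_
  have h1 : g⁻ ≤ β • m + (β * α) • g⁺ := by
    refine hβg.trans ((smul_le_smul_of_nonneg_left h hβ).trans ?_)
    rw [smul_add, mul_smul]
  have hβm : 0 ≤ β • m := smul_nonneg hβ hm0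
  have hβα : 0 ≤ β * α := mul_nonneg hβ hα
  calc g⁻ = (β • m + (β * α) • g⁺) ⊓ g⁻ := (inf_eq_right.2 h1).symm
    _ ≤ β • m ⊓ g⁻ + (β * α) • g⁺ ⊓ g⁻ :=
      add_inf_le_inf_add_inf hβm (smul_nonneg hβα (posPart_nonneg g)) (negPart_nonneg g)
    _ ≤ β • m + (1 + β * α) • (g⁻ ⊓ g⁺) := by
      refine add_le_add inf_le_left ?_
      rw [inf_comm]
      exact inf_smul_le (negPart_nonneg g) (posPart_nonneg g) hβα
    _ = β • m := by rw [inf_comm, posPart_inf_negPart_eq_zero, smul_zero, add_zero]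

/-- A maximal proper ideal `M` is a hyperplane complementary to the line spanned by the unit: the
`t` with `g - t u ∈ M` is the infimum of the `t` with `(g - t u)⁺ ∈ M`. -/
theorem exists_sub_smul_mem_of_maximal {u : E} (hu : IsStrongUnit u) {M : Submodule ℝ E}
    (hM : Maximal (fun M : Submodule ℝ E => IsIdeal M ∧ u ∉ M) M) (g : E) :
    ∃ t : ℝ, g - t • u ∈ M := by
  obtain ⟨α, hα, hg⟩ := hu.2 g
  obtain ⟨hg1, hg2⟩ := abs_le'.1 hg
  set A : Set ℝ := {t | (g - t • u)⁺ ∈ M} with hA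
  have hne : A.Nonempty := by
    refine ⟨α, ?_⟩
    change (g - α • u)⁺ ∈ M
    rw [posPart_eq_zero.2 (sub_nonpos.2 hg1)]
    exact zero_mem _
  have hbdd : BddBelow A := by
    refine ⟨-α - 1, fun t ht => ?_⟩
    by_contra! hlt
    refine hM.prop.2 (mem_of_isIdeal_of_le hM.prop.1 ht hu.1 (le_trans ?_ (le_posPart _)))
    have h1 : (1 : ℝ) • u ≤ (-α - t) • u := smul_le_smul_of_nonneg_right (by linarith) hu.1
    rw [one_smul, sub_smul, neg_smul] at h1
    exact h1.trans (sub_le_sub_right (neg_le.1 hg2) _)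
  have hmono : ∀ ⦃s t : ℝ⦄, s ≤ t → g - t • u ≤ g - s • u := fun s t hst =>
    sub_le_sub_left (smul_le_smul_of_nonneg_right hst hu.1) _
  refine ⟨sInf A, ?_⟩
  set t₀ := sInf A
  by_contra hnot
  have habs : |g - t₀ • u| ∉ M := fun h => hnot (hM.prop.1 h (abs_abs _).ge)
  obtain ⟨m, hm, hm0, β, hβ, h⟩ := exists_le_add_smul_of_maximal hM (abs_nonneg _) habs
  -- `ε` is chosen so that `β * ε ≤ 1 / 2`
  set ε : ℝ := 1 / (2 * (β + 1)) with hε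
  have hε0 : 0 < ε := by positivity
  have hβε : β * ε ≤ 1 / 2 := by
    rw [hε, mul_one_div, div_le_div_iff₀ (by positivity) two_pos]; linarith
  have hp : (g - (t₀ + ε) • u)⁺ ∈ M := by
    obtain ⟨t, ht, htlt⟩ := exists_lt_of_csInf_lt hne (lt_add_of_pos_right t₀ hε0)
    exact mem_of_isIdeal_of_le hM.prop.1 ht (posPart_nonneg _) (posPart_mono (hmono htlt.le))
  have hnotA : t₀ - ε ∉ A := notMem_of_lt_csInf (sub_lt_self _ hε0) hbdd
  have hn : (g - (t₀ - ε) • u)⁻ ∈ M := negPart_mem_of_maximal hu hM hnotA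
  set p := (g - (t₀ + ε) • u)⁺
  set n := (g - (t₀ - ε) • u)⁻
  have hp0 : 0 ≤ p := posPart_nonneg _
  have hn0 : 0 ≤ n := negPart_nonneg _
  have hεu : 0 ≤ ε • u := smul_nonneg hε0.le hu.1
  have hle : |g - t₀ • u| ≤ ε • u + (p + n) := by
    refine abs_le'.2 ⟨?_, ?_⟩
    · have h1 : g - (t₀ + ε) • u ≤ p := le_posPart _
      calc g - t₀ • u = ε • u + (g - (t₀ + ε) • u) := by rw [add_smul]; abel
        _ ≤ ε • u + (p + n) := by
          gcongr
          exact h1.trans (le_add_of_nonneg_right hn0)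
    · have h1 : -(g - (t₀ - ε) • u) ≤ n := neg_le_negPart _
      calc -(g - t₀ • u) = ε • u + -(g - (t₀ - ε) • u) := by rw [sub_smul]; abel
        _ ≤ ε • u + (p + n) := by
          gcongr
          exact h1.trans (le_add_of_nonneg_left hp0)
  have hmem : m + β • (p + n) ∈ M := add_mem hm (M.smul_mem _ (add_mem hp hn))
  have hhalf : (1 / 2 : ℝ) • u ≤ m + β • (p + n) := by
    have h2 : u ≤ (m + β • (p + n)) + (1 / 2 : ℝ) • u := by
      calc u ≤ m + β • |g - t₀ • u| := h
        _ ≤ m + β • (ε • u + (p + n)) := by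
          gcongr
        _ = (m + β • (p + n)) + (β * ε) • u := by rw [smul_add, mul_smul]; abel
        _ ≤ (m + β • (p + n)) + (1 / 2 : ℝ) • u := by
          gcongr
          exact hu.1
    have h3 : u = (1 / 2 : ℝ) • u + (1 / 2 : ℝ) • u := by rw [← add_smul]; norm_num
    nth_rewrite 1 [h3] at h2
    exact le_of_add_le_add_right h2
  have := mem_of_isIdeal_of_le hM.prop.1 hmem (smul_nonneg (by norm_num) hu.1) hhalf
  exact hM.prop.2 ((M.smul_mem_iff (by norm_num)).1 this)

/-- The real lattice homomorphisms `φ` on `E` with `φ u = 1`. -/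
def unitCharacters (u : E) : Set (E → ℝ) :=
  {φ | (∀ f g, φ (f + g) = φ f + φ g) ∧ (∀ (c : ℝ) f, φ (c • f) = c * φ f) ∧
    (∀ f g, φ (f ⊔ g) = φ f ⊔ φ g) ∧ (∀ f g, φ (f ⊓ g) = φ f ⊓ φ g) ∧ φ u = 1}

theorem exists_unitCharacter_of_maximal {u : E} (hu : IsStrongUnit u) {M : Submodule ℝ E}
    (hM : Maximal (fun M : Submodule ℝ E => IsIdeal M ∧ u ∉ M) M) :
    ∃ φ ∈ unitCharacters u, ∀ f ∈ M, φ f = 0 := by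
  choose φ hφ using exists_sub_smul_mem_of_maximal hu hM
  have huniq : ∀ {g : E} {t : ℝ}, g - t • u ∈ M → φ g = t := by
    intro g t ht
    by_contra hne
    have h1 : (φ g - t) • u ∈ M := by
      have := sub_mem ht (hφ g)
      rwa [sub_sub_sub_cancel_left, ← sub_smul] at this
    exact hM.prop.2 ((M.smul_mem_iff (sub_ne_zero.2 hne)).1 h1)
  have hadd : ∀ f g, φ (f + g) = φ f + φ g := fun f g => huniq <| by
    have := add_mem (hφ f) (hφ g)
    rwa [← add_sub_add_comm, ← add_smul] at this
  have hsmul : ∀ (c : ℝ) f, φ (c • f) = c * φ f := fun c f => huniq <| by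
    have := M.smul_mem c (hφ f)
    rwa [smul_sub, smul_smul] at this
  have hsup : ∀ f g, φ (f ⊔ g) = φ f ⊔ φ g := fun f g => huniq <| by
    have hu' : (φ f ⊔ φ g) • u = φ f • u ⊔ φ g • u := by
      rcases le_total (φ f) (φ g) with h | h
      · rw [sup_eq_right.2 h, sup_eq_right.2 (smul_le_smul_of_nonneg_right h hu.1)]
      · rw [sup_eq_left.2 h, sup_eq_left.2 (smul_le_smul_of_nonneg_right h hu.1)]
    have hmem := add_mem (abs_mem_of_isIdeal hM.prop.1 (hφ f))
      (abs_mem_of_isIdeal hM.prop.1 (hφ g))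
    refine hM.prop.1 hmem ?_
    rw [abs_of_nonneg (add_nonneg (abs_nonneg (f - φ f • u)) (abs_nonneg (g - φ g • u))), hu']
    calc |f ⊔ g - φ f • u ⊔ φ g • u|
        = |(f ⊔ g - φ f • u ⊔ g) + (φ f • u ⊔ g - φ f • u ⊔ φ g • u)| := by
          rw [sub_add_sub_cancel]
      _ ≤ |f ⊔ g - φ f • u ⊔ g| + |φ f • u ⊔ g - φ f • u ⊔ φ g • u| := abs_add_le _ _
      _ ≤ |f - φ f • u| + |g - φ g • u| := by
          refine add_le_add (abs_sup_sub_sup_le_abs _ _ _) ?_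
          rw [sup_comm (φ f • u), sup_comm (φ f • u)]
          exact abs_sup_sub_sup_le_abs _ _ _
  have hinf : ∀ f g, φ (f ⊓ g) = φ f ⊓ φ g := fun f g => by
    have h1 := hadd (f ⊓ g) (f ⊔ g)
    rw [inf_add_sup, hadd, hsup] at h1
    linarith [min_add_max (φ f) (φ g)]
  exact ⟨φ, ⟨hadd, hsmul, hsup, hinf, huniq (by simp)⟩, fun f hf => huniq (by simpa using hf)⟩

/-- If `E` is Archimedean then the characters separate its points. For `v ≠ 0` there
is an `ε > 0` such that `u` is not in the ideal generated by `a = (|v| - ε u)⁻`, and a character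
that vanishes on this ideal takes a value `≥ ε` at `|v|`. -/
theorem exists_unitCharacter_apply_ne_zero (hE : IsArchimedean E) {u : E} (hu : IsStrongUnit u)
    {v : E} (hv : v ≠ 0) : ∃ φ ∈ unitCharacters u, φ v ≠ 0 := by
  obtain ⟨ε, hε, hle⟩ : ∃ ε : ℝ, 0 < ε ∧ ¬ |v| ≤ ε • u := by
    by_contra! hall
    have h0 : |v| ≤ 0 := (hE u hu.1).2 <| by
      rintro _ ⟨n, rfl⟩
      exact hall _ Nat.one_div_pos_of_nat
    exact hv (le_antisymm ((le_abs_self v).trans h0) (neg_nonpos.1 ((neg_le_abs v).trans h0)))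
  set b := (|v| - ε • u)⁺ with hb
  set a := (|v| - ε • u)⁻ with ha
  have hb0 : 0 ≤ b := posPart_nonneg _
  have ha0 : 0 ≤ a := negPart_nonneg _
  have hua : u ∉ principalIdeal a := by
    rintro ⟨α, hα, h⟩
    rw [abs_of_nonneg hu.1, abs_of_nonneg ha0] at h
    obtain ⟨β, hβ, hβb⟩ := hu.2 b
    rw [abs_of_nonneg hb0] at hβb
    have h1 : b ≤ (β * α) • a := by
      rw [mul_smul]
      exact hβb.trans (smul_le_smul_of_nonneg_left h hβ)
    have h2 : b ≤ 0 := by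
      calc b = b ⊓ (β * α) • a := (inf_eq_left.2 h1).symm
        _ ≤ (1 + β * α) • (b ⊓ a) := inf_smul_le hb0 ha0 (mul_nonneg hβ hα)
        _ = 0 := by rw [hb, ha, posPart_inf_negPart_eq_zero, smul_zero]
    exact hle (sub_nonpos.1 (posPart_nonpos.1 h2))
  obtain ⟨M, hM₀, hM⟩ := exists_maximal_ideal (isIdeal_principalIdeal a) hua
  obtain ⟨φ, hφ, hφM⟩ := exists_unitCharacter_of_maximal hu hM
  refine ⟨φ, hφ, fun hv0 => ?_⟩
  obtain ⟨hadd, hsmul, hsup, -, hφu⟩ := hφ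
  have h0 : φ 0 = 0 := by simpa using hsmul 0 0
  have hneg : ∀ f, φ (-f) = -φ f := fun f => by simpa using hsmul (-1) f
  have hφa : φ a = 0 := hφM a (hM₀ ⟨1, zero_le_one, by simp⟩)
  have hφb : 0 ≤ φ b := by
    rw [hb, posPart_def, hsup, h0]; exact le_sup_right
  have hφabs : φ |v| = 0 := by
    change φ (v ⊔ -v) = 0
    rw [hsup, hneg, hv0]; simp
  have hdec : |v| = (b + -a) + ε • u := by
    rw [← sub_eq_add_neg, hb, ha, posPart_sub_negPart, sub_add_cancel]
  rw [hdec, hadd, hadd, hneg, hφa, hsmul, hφu] at hφabs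
  linarith

omit [IsOrderedAddMonoid E] [IsOrderedModule ℝ E] in
theorem isCompact_unitCharacters {u : E} (hu : IsStrongUnit u) :
    IsCompact (unitCharacters u) := by
  choose α _ hα using hu.2
  have hclosed : IsClosed (unitCharacters u) := by
    have h : ∀ f : E, Continuous fun φ : E → ℝ => φ f := fun f => continuous_apply f
    simp only [unitCharacters, Set.ofPred_and, Set.ofPred_forall]
    refine IsClosed.inter ?_ (IsClosed.inter ?_ (IsClosed.inter ?_ (IsClosed.inter ?_ ?_)))
    · exact isClosed_iInter fun f => isClosed_iInter fun g =>
        isClosed_eq (h _) ((h f).add (h g))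
    · exact isClosed_iInter fun c => isClosed_iInter fun f =>
        isClosed_eq (h _) (continuous_const.mul (h f))
    · exact isClosed_iInter fun f => isClosed_iInter fun g =>
        isClosed_eq (h _) ((h f).sup (h g))
    · exact isClosed_iInter fun f => isClosed_iInter fun g =>
        isClosed_eq (h _) ((h f).inf (h g))
    · exact isClosed_eq (h u) continuous_const
  refine (isCompact_univ_pi fun f => isCompact_Icc (a := -α f) (b := α f)).of_isClosed_subset
    hclosed fun φ hφ f _ => ?_
  obtain ⟨hadd, hsmul, hsup, -, hφu⟩ := hφ
  have hmono : ∀ {x y : E}, x ≤ y → φ x ≤ φ y := fun {x y} hxy => by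
    rw [← sup_eq_right.2 hxy, hsup]; exact le_sup_left
  have h1 := hmono ((le_abs_self f).trans (hα f))
  have h2 := hmono ((neg_le_abs f).trans (hα f))
  have h3 : φ (-f) = -φ f := by simpa using hsmul (-1) f
  rw [hsmul, hφu, mul_one] at h1 h2
  rw [h3] at h2
  exact ⟨neg_le.1 h2, h1⟩

/-- The Krein–Kakutani representation: evaluation at the characters, which is injective by
`exists_unitCharacter_apply_ne_zero` and has dense range by the lattice form of the
Stone–Weierstrass theorem. -/
theorem exists_isDenseRepresentation (hE : IsArchimedean E) {u : E} (hu : IsStrongUnit u) :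
    CompactSpace (unitCharacters u) ∧ T2Space (unitCharacters u) ∧
      ∃ T : E →ₗ[ℝ] C(unitCharacters u, ℝ), IsDenseRepresentation T := by
  have hcomp : CompactSpace (unitCharacters u) :=
    isCompact_iff_compactSpace.1 (isCompact_unitCharacters hu)
  refine ⟨hcomp, inferInstance, ?_⟩
  let T : E →ₗ[ℝ] C(unitCharacters u, ℝ) :=
    { toFun := fun f => ⟨fun φ => φ.1 f, (continuous_apply f).comp continuous_subtype_val⟩
      map_add' := fun f g => ContinuousMap.ext fun φ => φ.2.1 f g
      map_smul' := fun c f => ContinuousMap.ext fun φ => φ.2.2.1 c f }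
  have hTsup : ∀ f g, T (f ⊔ g) = T f ⊔ T g := fun f g =>
    ContinuousMap.ext fun φ => φ.2.2.2.1 f g
  have hTinf : ∀ f g, T (f ⊓ g) = T f ⊓ T g := fun f g =>
    ContinuousMap.ext fun φ => φ.2.2.2.2.1 f g
  refine ⟨T, hTsup, hTinf, ?_, ?_⟩
  · refine (injective_iff_map_eq_zero T).2 fun v hv => ?_
    by_contra hne
    obtain ⟨φ, hφ, hφv⟩ := exists_unitCharacter_apply_ne_zero hE hu hne
    exact hφv (congrArg (fun F : C(unitCharacters u, ℝ) => F ⟨φ, hφ⟩) hv)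
  · rw [DenseRange, dense_iff_closure_eq]
    refine ContinuousMap.sublattice_closure_eq_top _ (Set.range_nonempty _) ?_ ?_ ?_
    · rintro _ ⟨f, rfl⟩ _ ⟨g, rfl⟩
      exact ⟨f ⊓ g, hTinf f g⟩
    · rintro _ ⟨f, rfl⟩ _ ⟨g, rfl⟩
      exact ⟨f ⊔ g, hTsup f g⟩
    · intro v φ ψ
      have hTu : ∀ χ, T u χ = 1 := fun χ => χ.2.2.2.2.2
      by_cases hφψ : φ = ψ
      · subst hφψ
        exact ⟨T (v φ • u), ⟨_, rfl⟩, by simp [hTu], by simp [hTu]⟩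
      · obtain ⟨g, hg⟩ : ∃ g, φ.1 g ≠ ψ.1 g := by
          by_contra! h
          exact hφψ (Subtype.ext (funext h))
        have hg' : T g φ - T g ψ ≠ 0 := sub_ne_zero.2 hg
        -- the affine interpolation of the two prescribed values
        refine ⟨T (((v φ - v ψ) / (T g φ - T g ψ)) • (g - T g ψ • u) + v ψ • u), ⟨_, rfl⟩,
          ?_, ?_⟩ <;> simp [hTu, hg']

end Existence
/-! ### Projection bands and closures of open sets in the spectrum -/

section Projection

variable {F : Type*} [AddCommGroup F] [Lattice F] [IsOrderedAddMonoid F] [Module ℝ F]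
  [IsOrderedModule ℝ F]

instance (e : F) : IsOrderedAddMonoid (principalIdeal e) where
  add_le_add_left _ _ h c := add_le_add_left (α := F) h c

instance (e : F) : IsOrderedModule ℝ (principalIdeal e) where
  smul_le_smul_of_nonneg_left _ hc _ _ h := smul_le_smul_of_nonneg_left (β := F) h hc
  smul_le_smul_of_nonneg_right _ hf _ _ h := smul_le_smul_of_nonneg_right (β := F) h hf

theorem disjoint_coe_iff {e : F} {f g : principalIdeal e} :
    |(f : F)| ⊓ |(g : F)| = 0 ↔ |f| ⊓ |g| = 0 :=
  (Subtype.ext_iff (a1 := |f| ⊓ |g|) (a2 := 0)).symm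

theorem mem_principalIdeal_of_abs_le {e f : F} (h : |f| ≤ |e|) : f ∈ principalIdeal e :=
  ⟨1, zero_le_one, by rwa [one_smul]⟩

/-- `|e|` as an element of the principal ideal generated by `e`. -/
def principalUnit (e : F) : principalIdeal e :=
  ⟨|e|, mem_principalIdeal_of_abs_le (abs_abs e).le⟩

theorem isStrongUnit_principalUnit (e : F) : IsStrongUnit (principalUnit e) :=
  ⟨abs_nonneg e, fun f => f.2⟩

theorem IsArchimedean.principalIdeal (hF : IsArchimedean F) (e : F) :
    IsArchimedean (principalIdeal e) := by
  intro f hf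
  refine ⟨?_, fun b hb => (hF f hf).2 ?_⟩
  · rintro _ ⟨n, rfl⟩
    exact smul_nonneg Nat.one_div_pos_of_nat.le hf
  · rintro _ ⟨n, rfl⟩
    exact hb ⟨n, rfl⟩

theorem exists_isKreinKakutaniSpectrum {F : Type u} [AddCommGroup F] [Lattice F]
    [IsOrderedAddMonoid F] [Module ℝ F] [IsOrderedModule ℝ F] (hF : IsArchimedean F) (e : F) :
    ∃ (K : Type u) (_ : TopologicalSpace K), IsKreinKakutaniSpectrum e K := by
  obtain ⟨h1, h2, T, hT⟩ :=
    exists_isDenseRepresentation (hF.principalIdeal e) (isStrongUnit_principalUnit e)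
  exact ⟨_, _, h1, h2, T, hT.map_sup, hT.map_inf, hT.injective, hT.dense⟩

theorem isProjectionBand_of_nonneg {H : Submodule ℝ F} (hH : IsIdeal H)
    (h : ∀ f : F, 0 ≤ f → ∃ g ∈ H, ∃ h ∈ disjointComplement (H : Set F), f = g + h) :
    IsProjectionBand H := by
  refine ⟨hH, fun f => ?_⟩
  obtain ⟨g₁, hg₁, h₁, hh₁, hf₁⟩ := h f⁺ (posPart_nonneg f)
  obtain ⟨g₂, hg₂, h₂, hh₂, hf₂⟩ := h f⁻ (negPart_nonneg f)
  refine ⟨g₁ - g₂, sub_mem hg₁ hg₂, h₁ - h₂,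
    sub_mem (H := disjointSubmodule (H : Set F)) hh₁ hh₂, ?_⟩
  rw [← posPart_sub_negPart f, hf₁, hf₂]
  abel

variable {K : Type*} [TopologicalSpace K] [CompactSpace K] [T2Space K]

theorem isOpen_closure_of_isProjectionBand {e : F} {T : principalIdeal e →ₗ[ℝ] C(K, ℝ)}
    (hT : IsDenseRepresentation T) {B : Set (principalIdeal e)} {H : Submodule ℝ F}
    (hH : IsBandGeneratedBy H ((↑) '' B)) (hp : IsProjectionBand H) :
    IsOpen (closure (⋃ b ∈ B, {x | T b x ≠ 0})) := by
  obtain ⟨g, hg, h, hh, hgh⟩ := hp.2 |e|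
  have hd : |g| ⊓ |h| = 0 := by rw [inf_comm]; exact hh g hg
  have hge : g ∈ principalIdeal e :=
    mem_principalIdeal_of_abs_le ((abs_le_of_disjoint_add hd hgh).trans_eq (abs_abs e))
  have hhe : h ∈ principalIdeal e := mem_principalIdeal_of_abs_le <|
    (abs_le_of_disjoint_add (hh g hg) (hgh.trans (add_comm g h))).trans_eq (abs_abs e)
  refine hT.isOpen_closure_of_decomposition (isStrongUnit_principalUnit e)
    (g := ⟨g, hge⟩) (h := ⟨h, hhe⟩) (Subtype.ext hgh) (disjoint_coe_iff.1 hd)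
    (fun b hb => disjoint_coe_iff.1 (hh b (hH.2.1 ⟨b, hb, rfl⟩)))
    fun f hf => disjoint_coe_iff.1 (hH.disjoint ?_ hg)
  rintro _ ⟨b, hb, rfl⟩
  exact disjoint_coe_iff.2 (hf b hb)

theorem abs_inf_mem_principalIdeal {f : F} (hf : 0 ≤ f) (g : F) :
    |g| ⊓ f ∈ principalIdeal f := by
  refine mem_principalIdeal_of_abs_le ?_
  rw [abs_of_nonneg (le_inf (abs_nonneg g) hf), abs_of_nonneg hf]
  exact inf_le_right

/-- The element `p` is the supremum of the part of the band `H` below it: if `z` were a smaller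
upper bound, `p - z ⊓ p` would dominate some nonzero `k ≥ 0` in `H`, and adding `k` repeatedly
would give `n k ≤ p` for all `n`. -/
theorem mem_of_isBand_of_forall_exists (hF : IsArchimedean F) {H : Submodule ℝ F}
    (hH : IsBand H) {p : F} (hp : 0 ≤ p)
    (h : ∀ r : F, 0 ≤ r → r ≤ p → r ≠ 0 → ∃ k ∈ H, 0 ≤ k ∧ k ≤ r ∧ k ≠ 0) : p ∈ H := by
  refine hH.2 {g | g ∈ H ∧ 0 ≤ g ∧ g ≤ p} (fun g hg => hg.1) p ⟨fun g hg => hg.2.2, ?_⟩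
  intro z hz
  have hz0 : 0 ≤ z := hz ⟨zero_mem H, le_rfl, hp⟩
  by_contra hpz
  obtain ⟨k, hkH, hk0, hkr, hk⟩ := h (p - z ⊓ p) (sub_nonneg.2 inf_le_right)
    (sub_le_self _ (le_inf hz0 hp)) fun h0 => hpz (by
      rw [sub_eq_zero.1 h0]; exact inf_le_left)
  have hstep : ∀ n : ℕ, (n : ℝ) • k ≤ p := by
    intro n
    induction n with
    | zero => simpa using hp
    | succ n ih =>
      have hn0 : 0 ≤ (n : ℝ) • k := smul_nonneg n.cast_nonneg hk0
      have hnz : (n : ℝ) • k ≤ z := hz ⟨H.smul_mem _ hkH, hn0, ih⟩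
      calc ((n + 1 : ℕ) : ℝ) • k = (n : ℝ) • k + k := by
            rw [Nat.cast_succ, add_smul, one_smul]
        _ ≤ z ⊓ p + (p - z ⊓ p) := add_le_add (le_inf hnz ih) hkr
        _ = p := add_sub_cancel _ _
  refine hk (le_antisymm (hF.nonpos_of_nsmul_le hp fun n => ?_) hk0)
  exact_mod_cast hstep (n + 1)

omit [T2Space K] in
/-- If the supports of the truncations `|g| ⊓ f`, `g ∈ G`, have a union with open closure `V`, then
the component of `f` carried by `V` is the projection of `f` to the band generated by `G`. -/
theorem exists_decomposition_of_isOpen_closure (hF : IsArchimedean F) {f : F} (hf : 0 ≤ f)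
    {T : principalIdeal f →ₗ[ℝ] C(K, ℝ)} (hT : IsDenseRepresentation T) {H : Submodule ℝ F}
    {G : Set F} (hH : IsBandGeneratedBy H G)
    (hV : IsOpen (closure (⋃ g ∈ G, {x | T ⟨|g| ⊓ f, abs_inf_mem_principalIdeal hf g⟩ x ≠ 0}))) :
    ∃ g ∈ H, ∃ h ∈ disjointComplement (H : Set F), f = g + h := by
  have hu := isStrongUnit_principalUnit f
  have huf : (principalUnit f : F) = f := abs_of_nonneg hf
  let m : F → principalIdeal f := fun g => ⟨|g| ⊓ f, abs_inf_mem_principalIdeal hf g⟩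
  have hm0 : ∀ g, 0 ≤ m g := fun g => le_inf (abs_nonneg g) hf
  set U : Set K := ⋃ g ∈ G, {x | T (m g) x ≠ 0} with hU
  obtain ⟨p, hp0, hpu, hpV, hpV'⟩ := hT.exists_component hu ⟨isClosed_closure, hV⟩
  have hq0 : 0 ≤ principalUnit f - p := sub_nonneg.2 hpu
  refine ⟨p, ?_, (principalUnit f - p : principalIdeal f), fun h hh => ?_, ?_⟩
  · refine mem_of_isBand_of_forall_exists hF hH.1 hp0 fun r hr0 hrp hr => ?_
    obtain ⟨r, rfl⟩ : ∃ r' : principalIdeal f, (r' : F) = r :=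
      ⟨⟨r, mem_of_isIdeal_of_le (isIdeal_principalIdeal f) p.2 hr0 hrp⟩, rfl⟩
    obtain ⟨x₀, hx₀⟩ : ∃ x₀, T r x₀ ≠ 0 := by
      by_contra! hall
      exact hr (congrArg Subtype.val (hT.eq_of_apply (g := 0) fun x => by simp [hall x]))
    have hx₀V : x₀ ∈ closure U := by
      by_contra hx
      exact hx₀ (le_antisymm ((hT.mono hrp x₀).trans_eq (hpV' x₀ hx)) (hT.nonneg hr0 x₀))
    obtain ⟨x, hxr, hxU⟩ := mem_closure_iff.1 hx₀V {x | T r x ≠ 0}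
      (isOpen_ne_fun (T r).continuous continuous_const) hx₀
    obtain ⟨g, hg, hxg⟩ := Set.mem_iUnion₂.1 hxU
    have hk : T (m g ⊓ r) x ≠ 0 := by
      rw [hT.inf_apply]
      exact (lt_inf_iff.2 ⟨(hT.nonneg (hm0 g) x).lt_of_ne' hxg,
        (hT.nonneg hr0 x).lt_of_ne' hxr⟩).ne'
    have hk0 : 0 ≤ m g ⊓ r := le_inf (hm0 g) hr0
    refine ⟨(m g ⊓ r : principalIdeal f), ?_, hk0, inf_le_right (α := principalIdeal f),
      fun h0 => hk ?_⟩
    · refine mem_of_isIdeal_of_le hH.1.1 (abs_mem_of_isIdeal hH.1.1 (hH.2.1 hg)) hk0 ?_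
      exact (inf_le_left (α := F)).trans inf_le_left
    · rw [show m g ⊓ r = 0 from Subtype.ext h0]; simp
  · refine hH.disjoint (fun g hg => ?_) hh
    have hdisj : |principalUnit f - p| ⊓ |m g| = 0 := hT.disjoint_iff.2 fun x => by
      by_cases hx : T (m g) x = 0
      · exact Or.inr hx
      · left
        rw [map_sub, ContinuousMap.sub_apply, sub_eq_zero]
        exact (hpV x (subset_closure (Set.mem_biUnion hg hx))).symm
    have hqf : |((principalUnit f - p : principalIdeal f) : F)| ≤ f := by
      rw [abs_of_nonneg (show (0 : F) ≤ _ from hq0)]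
      exact (sub_le_self (principalUnit f : F) hp0).trans_eq huf
    refine le_antisymm ?_ (le_inf (abs_nonneg _) (abs_nonneg _))
    calc |((principalUnit f - p : principalIdeal f) : F)| ⊓ |g|
        ≤ |((principalUnit f - p : principalIdeal f) : F)| ⊓ |(m g : F)| := by
          refine le_inf inf_le_left ?_
          rw [abs_of_nonneg (show (0 : F) ≤ m g from hm0 g)]
          exact le_inf inf_le_right (inf_le_left.trans hqf)
      _ = 0 := disjoint_coe_iff.2 hdisj
  · change f = (p : F) + (principalUnit f - p)
    rw [add_sub_cancel, huf]

/-- A countable union of cozero sets is a cozero set. -/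
theorem exists_cozero_eq_biUnion {ι : Type*} {G : Set ι} (hG : G.Countable) (φ : ι → C(K, ℝ)) :
    ∃ ψ : C(K, ℝ), {x | ψ x ≠ 0} = ⋃ g ∈ G, {x | φ g x ≠ 0} := by
  have := hG.toEncodable
  let t : G → C(K, ℝ) := fun g => ((1 / 2 : ℝ) ^ Encodable.encode g) • (|φ g| ⊓ 1)
  have ht0 : ∀ g x, 0 ≤ t g x := fun g x =>
    mul_nonneg (by positivity) (le_inf (abs_nonneg (φ g x)) zero_le_one)
  have hsum : Summable t := by
    refine Summable.of_norm_bounded summable_geometric_two_encode fun g => ?_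
    refine (ContinuousMap.norm_le _ (by positivity)).2 fun x => ?_
    rw [Real.norm_of_nonneg (ht0 g x)]
    exact mul_le_of_le_one_right (by positivity) inf_le_right
  refine ⟨∑' g, t g, Set.ext fun x => ?_⟩
  have hx : HasSum (fun g => t g x) ((∑' g, t g) x) := ContinuousMap.hasSum_apply hsum.hasSum x
  have htx : ∀ g, t g x = 0 ↔ φ g x = 0 := fun g => by
    change (1 / 2 : ℝ) ^ Encodable.encode g * (|φ g x| ⊓ 1) = 0 ↔ _
    rw [mul_eq_zero, or_iff_right (by positivity)]
    constructor
    · intro h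
      rcases min_choice |φ g x| 1 with h1 | h1
      · exact abs_eq_zero.1 (h1.symm.trans h)
      · exact absurd (h1.symm.trans h) one_ne_zero
    · intro h
      simp [h]
  simp only [Set.mem_iUnion, Set.mem_ofPred_eq]
  rw [ne_eq, ← not_iff_not, not_not]
  push Not
  constructor
  · intro h g hg
    rw [h] at hx
    exact (htx ⟨g, hg⟩).1 (congrFun ((hasSum_zero_iff_of_nonneg fun g => ht0 g x).1 hx) ⟨g, hg⟩)
  · intro h
    refine hx.unique ?_
    simp only [fun g : G => (htx g).2 (h g g.2)]
    exact hasSum_zero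

end Projection

/-! ### The projection properties and the spectra -/

section Main

variable {F : Type*} [AddCommGroup F] [Lattice F] [IsOrderedAddMonoid F] [Module ℝ F]
  [IsOrderedModule ℝ F] {K : Type*} [TopologicalSpace K]

theorem HasPP.extremallyDisconnected (h : HasPP F) {e : F} (hK : IsKreinKakutaniSpectrum e K) :
    ExtremallyDisconnected K := by
  obtain ⟨_, _, T, hsup, hinf, hinj, hdense⟩ := hK
  have hT : IsDenseRepresentation T := ⟨hsup, hinf, hinj, hdense⟩
  refine ⟨fun U hU => ?_⟩
  obtain ⟨H, hH⟩ := exists_isBandGeneratedBy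
    ((↑) '' {b : principalIdeal e | ∀ x ∉ U, T b x = 0} : Set F)
  have hopen := isOpen_closure_of_isProjectionBand hT hH (h H hH.1)
  suffices ⋃ b ∈ {b : principalIdeal e | ∀ x ∉ U, T b x = 0}, {x | T b x ≠ 0} = U by
    rwa [this] at hopen
  refine subset_antisymm (Set.iUnion₂_subset fun b hb x hx => ?_) fun x hx => ?_
  · by_contra hxU
    exact hx (hb x hxU)
  · obtain ⟨b, -, hb0, hbx⟩ := hT.exists_bump (isStrongUnit_principalUnit e) hU hx
    exact Set.mem_biUnion (show b ∈ {b | ∀ x ∉ U, T b x = 0} from hb0) hbx.ne'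

theorem HasSigmaPP.basicallyDisconnected (h : HasSigmaPP F) {e : F}
    (hK : IsKreinKakutaniSpectrum e K) : BasicallyDisconnected K := by
  obtain ⟨_, _, T, hsup, hinf, hinj, hdense⟩ := hK
  have hT : IsDenseRepresentation T := ⟨hsup, hinf, hinj, hdense⟩
  intro φ
  obtain ⟨b, hb⟩ := hT.exists_iUnion_eq_cozero (isStrongUnit_principalUnit e) φ
  obtain ⟨H, hH⟩ := exists_isBandGeneratedBy ((↑) '' Set.range b : Set F)
  have hopen := isOpen_closure_of_isProjectionBand hT hH
    (h H ⟨_, (Set.countable_range b).image _, hH⟩)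
  rwa [Set.biUnion_range, ← hb] at hopen

theorem hasPP_of_extremallyDisconnected (hF : IsArchimedean F)
    (h : ∀ e : F, ∃ (K : Type u) (_ : TopologicalSpace K),
      IsKreinKakutaniSpectrum e K ∧ ExtremallyDisconnected K) : HasPP F := by
  refine fun H hH => isProjectionBand_of_nonneg hH.1 fun f hf => ?_
  obtain ⟨K, _, ⟨_, _, T, hsup, hinf, hinj, hdense⟩, hK⟩ := h f
  refine exists_decomposition_of_isOpen_closure hF hf ⟨hsup, hinf, hinj, hdense⟩
    (G := H) ⟨hH, le_rfl, fun _ _ h => h⟩ (hK.open_closure _ ?_)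
  exact isOpen_biUnion fun g _ => isOpen_ne_fun (T _).continuous continuous_const

theorem hasSigmaPP_of_basicallyDisconnected (hF : IsArchimedean F)
    (h : ∀ e : F, ∃ (K : Type u) (_ : TopologicalSpace K),
      IsKreinKakutaniSpectrum e K ∧ BasicallyDisconnected K) : HasSigmaPP F := by
  rintro H ⟨G, hG, hH⟩
  refine isProjectionBand_of_nonneg hH.1.1 fun f hf => ?_
  obtain ⟨K, _, ⟨_, _, T, hsup, hinf, hinj, hdense⟩, hK⟩ := h f
  refine exists_decomposition_of_isOpen_closure hF hf ⟨hsup, hinf, hinj, hdense⟩ hH ?_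
  obtain ⟨ψ, hψ⟩ := exists_cozero_eq_biUnion hG
    fun g => T ⟨|g| ⊓ f, abs_inf_mem_principalIdeal hf g⟩
  rw [← hψ]
  exact hK ψ

end Main
end VectorLattice

theorem corollary3p14 {F : Type u} [AddCommGroup F] [Lattice F] [IsOrderedAddMonoid F]
    [Module ℝ F] [IsOrderedModule ℝ F] (hF : VectorLattice.IsArchimedean F) :
    [VectorLattice.HasPP F,
      ∀ (e : F) (K : Type u) [TopologicalSpace K],
        VectorLattice.IsKreinKakutaniSpectrum e K → ExtremallyDisconnected K,
      ∀ e : F, ∃ (K : Type u) (_ : TopologicalSpace K),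
        VectorLattice.IsKreinKakutaniSpectrum e K ∧ ExtremallyDisconnected K].TFAE ∧
    [VectorLattice.HasSigmaPP F,
      ∀ (e : F) (K : Type u) [TopologicalSpace K],
        VectorLattice.IsKreinKakutaniSpectrum e K → VectorLattice.BasicallyDisconnected K,
      ∀ e : F, ∃ (K : Type u) (_ : TopologicalSpace K),
        VectorLattice.IsKreinKakutaniSpectrum e K ∧
          VectorLattice.BasicallyDisconnected K].TFAE := by
  constructor
  · tfae_have 1 → 2 := fun h e K _ hK => h.extremallyDisconnected hK
    tfae_have 2 → 3 := fun h e => by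
      obtain ⟨K, _, hK⟩ := VectorLattice.exists_isKreinKakutaniSpectrum hF e
      exact ⟨K, _, hK, h e K hK⟩
    tfae_have 3 → 1 := VectorLattice.hasPP_of_extremallyDisconnected hF
    tfae_finish
  · tfae_have 1 → 2 := fun h e K _ hK => h.basicallyDisconnected hK
    tfae_have 2 → 3 := fun h e => by
      obtain ⟨K, _, hK⟩ := VectorLattice.exists_isKreinKakutaniSpectrum hF e
      exact ⟨K, _, hK, h e K hK⟩
    tfae_have 3 → 1 := VectorLattice.hasSigmaPP_of_basicallyDisconnected hF
    tfae_finish
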